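/- Theorem (Convergence of KDE approximations of push-forward densities). Let $\Lambda\subset\mathbb{R}^k$ with a dominating Borel measure $\mu_\Lambda$, let $P_\Lambda$ be a probability measure on $\Lambda$ with a density with respect to $\mu_\Lambda$, and let $Q:\Lambda\to\mathbb{R}^m$ be measurable, $\mathcal{D}=Q(\Lambda)$. Suppose that the push-forward of $P_\Lambda$ under $Q$ has a density $\pi^Q\ge 0$ with respect to Lebesgue measure on $\mathbb{R}^m$. Let $s\ge 1$ be an integer and assume: * $\pi^Q\in C^s(\mathbb{R}^m)$, and $\pi^Q$ and its derivatives of order $s$ are uniformly continuous on $\mathbb{R}^m$; * $K:\mathbb{R}^m\to\mathbb{R}$ is a bounded, integrable, Lipschitz continuous kernel of order $s$, i.e. $\int K=1$, $\int \|u\|^s|K(u)|\,du<\infty$, and $\int u^\alpha K(u)\,du=0$ for all multi-indices $\alpha$ with $1\le|\alpha|\le s-1$; * the bandwidths satisfy $h_M>0$ for $M\ge 2$ and $h_M\asymp(\log M/M)^{1/(2s+m)}$ as $M\to\infty$ (two-sided bounds with positive constants). Let $\lambda_1,\lambda_2,\dots$ be independent samples of $P_\Lambda$. For a measurable map $Q_n:\Lambda\to\mathbb{R}^m$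 and $M\ge 2$ let $$\hat\pi^{Q_n}(q)=\frac{1}{M h_M^m}\sum_{i=1}^M K\!\left(\frac{q-Q_n(\lambda_i)}{h_M}\right)$$ be the kernel density estimate built from $M$ samples of the approximate model $Q_n$. Write $\|Q-Q_n\|_\infty$ for the norm of $Q-Q_n$ in $L^\infty(\Lambda,\mu_\Lambda)$; $\mathcal{D}$ carries Lebesgue measure. Consider the two bounds $$\|\pi^Q-\hat\pi^{Q_n}\|_{L^\infty(\mathcal{D})}\le C\left(\Big(\frac{\log M}{M}\Big)^{\frac{s}{2s+m}}+\frac{1}{h_M^{m+1}}\,\|Q-Q_n\|_\infty\right),$$ $$\|\pi^Q\circ Q-\hat\pi^{Q_n}\circ Q_n\|_{L^\infty(\Lambda,\mu_\Lambda)}\le C\left(\Big(\frac{\log M}{M}\Big)^{\frac{s}{2s+m}}+\frac{1}{h_M^{m+1}}\,\|Q-Q_n\|_\infty\right).$$ There is a constant $C>0$, depending neither on $M$, nor on $n$, nor on the maps $Q_n$, nor on the realization of the samples, such that for every sequence $(Q_n)$ of measurable maps $\Lambda\to\mathbb{R}^m$, almost surely: both bounds hold for all sufficiently large $M$ and all $n$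 simultaneously (how large may depend on the realization, not on $n$); and both bounds hold for all $M\ge 2$ and all $n$ simultaneously if $C$ is replaced by a suitable constant $C'>0$ that may depend on the realization and on the sequence $(Q_n)$, but not on $M$ or $n$. (In particular, for a fixed number $M$ of samples both errors are at most $C_M\big((\log M/M)^{s/(2s+m)}+\|Q-Q_n\|_\infty\big)$ for all $n$, with $C_M=C\max(1,h_M^{-(m+1)})$ or $C'\max(1,h_M^{-(m+1)})$ respectively.) -/

import Mathlib

open MeasureTheory ProbabilityTheory Filter Asymptotics
open scoped ENNReal Topology

/-- `K : ℝᵐ → ℝ` is an `s`-th order kernel: it is Lebesgue integrable with integral one, its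
`s`-th absolute moment is finite, and all its moments of the orders `1, …, s - 1` vanish. -/
structure IsKernelOfOrder {m : ℕ} (s : ℕ) (K : EuclideanSpace ℝ (Fin m) → ℝ) : Prop where
  integrable : Integrable K
  integral_eq_one : ∫ u, K u = 1
  integrable_moment : Integrable (fun u => ‖u‖ ^ s * K u)
  moment_eq_zero : ∀ α : Fin m → ℕ, 1 ≤ ∑ i, α i → ∑ i, α i < s →
    ∫ u, (∏ i, u i ^ α i) * K u = 0

/-- The kernel density estimate with kernel `K` and bandwidth `h` built from the `M` points
`x 0, …, x (M - 1)` of `ℝᵐ`, evaluated at `q`. -/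
noncomputable def kde {m : ℕ} (K : EuclideanSpace ℝ (Fin m) → ℝ) (h : ℝ) (M : ℕ)
    (x : ℕ → EuclideanSpace ℝ (Fin m)) (q : EuclideanSpace ℝ (Fin m)) : ℝ :=
  (1 / ((M : ℝ) * h ^ m)) * ∑ i ∈ Finset.range M, K (h⁻¹ • (q - x i))

/-- The rate `(log M / M) ^ (s / (2 s + m))`. -/
noncomputable def kdeRate (s m M : ℕ) : ℝ :=
  (Real.log M / M) ^ ((s : ℝ) / (2 * s + m))

/-- The bandwidths are positive and of the exact order `(log M / M) ^ (1 / (2 s + m))`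
that balances the bias and the stochastic error of the estimate. -/
def IsRateBandwidth (s m : ℕ) (h : ℕ → ℝ) : Prop :=
  (∀ M, 2 ≤ M → 0 < h M) ∧
    h =Θ[atTop] fun M : ℕ => (Real.log M / M) ^ ((1 : ℝ) / (2 * s + m))

/-- The two error bounds, with the constant `C`, for the estimate built from the `M` points
`Q' (l 0), …, Q' (l (M - 1))` with bandwidth `h`: the first in `L^∞` over the range of `Q`,
the second, with the estimate evaluated at `Q'`, in `L^∞` over the parameter space. -/
def KDEErrorBounds {k m : ℕ} {Λ : Set (EuclideanSpace ℝ (Fin k))} (μΛ : Measure Λ)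
    (Q Q' : Λ → EuclideanSpace ℝ (Fin m)) (dens K : EuclideanSpace ℝ (Fin m) → ℝ)
    (s : ℕ) (h : ℝ) (M : ℕ) (l : ℕ → Λ) (C : ℝ) : Prop :=
  eLpNorm (fun q => dens q - kde K h M (fun i => Q' (l i)) q) ∞
      (volume.restrict (Set.range Q))
    ≤ ENNReal.ofReal C * (ENNReal.ofReal (kdeRate s m M) +
        ENNReal.ofReal (1 / h ^ (m + 1)) * eLpNorm (fun x => Q x - Q' x) ∞ μΛ) ∧
  eLpNorm (fun x => dens (Q x) - kde K h M (fun i => Q' (l i)) (Q' x)) ∞ μΛ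
    ≤ ENNReal.ofReal C * (ENNReal.ofReal (kdeRate s m M) +
        ENNReal.ofReal (1 / h ^ (m + 1)) * eLpNorm (fun x => Q x - Q' x) ∞ μΛ)

/-! The error splits into bias, stochastic error and model error.

Bias: a uniformly continuous density is bounded. A bounded function with uniformly continuous `s`-th
derivative has bounded `s`-th derivative, so Taylor expansion along lines and the vanishing moments
leave a remainder of order `h ^ s` (`IsKernelOfOrder.exists_abs_integral_sub_le`).

Stochastic error: let `Z q` be the centered kernel sum at `q`. Instead of a covering argument, `cosh
(t * Z q) - 1` is integrated over all `q`. Its expectation is at most a multiple of the second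
moment of one summand, whose integral over `q` is finite by Tonelli, so the unboundedness of `ℝᵐ`
does no harm. Since `Z` is Lipschitz, one large value forces a large integral, and Markov's
inequality bounds the supremum (`measure_exists_le_abs_sum_le`). A suitable `t` gives tails of order
`M⁻²`, and Borel-Cantelli concludes.

Model error: `K` is Lipschitz, so moving the samples and the evaluation point by at most `e` costs
`2 * L * e / h ^ (m + 1)`. The stochastic event involves `Q` only, which makes the bounds uniform in
`n`. -/

/-! ### Bounded derivatives and Taylor expansion along lines -/

/-- A function bounded on an interval has a point there at which its `s`-th derivative is
controlled by the bound. -/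
theorem exists_abs_iteratedDeriv_le (s : ℕ) :
    ∀ δ : ℝ, 0 < δ → ∃ c : ℝ, 0 ≤ c ∧ ∀ (φ : ℝ → ℝ) (a D : ℝ), ContDiff ℝ s φ →
      (∀ x ∈ Set.Icc a (a + δ), |φ x| ≤ D) →
      ∃ ξ ∈ Set.Icc a (a + δ), |iteratedDeriv s φ ξ| ≤ c * D := by
  induction s with
  | zero =>
    intro δ hδ
    refine ⟨1, zero_le_one, fun φ a D _ hD => ⟨a, ⟨le_rfl, by linarith⟩, ?_⟩⟩
    simpa using hD a ⟨le_rfl, by linarith⟩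
  | succ s ih =>
    intro δ hδ
    -- Points from the two outer thirds are at least `δ / 3` apart; the mean value theorem between
    -- them yields the next derivative.
    obtain ⟨c, hc, H⟩ := ih (δ / 3) (by positivity)
    refine ⟨2 * c / (δ / 3), by positivity, fun φ a D hφ hD => ?_⟩
    have hφ' : ContDiff ℝ s φ := hφ.of_le (by exact_mod_cast Nat.le_succ s)
    obtain ⟨x, hx, hxb⟩ := H φ a D hφ' fun y hy => hD y ⟨hy.1, by linarith [hy.2]⟩
    obtain ⟨y, hy, hyb⟩ := H φ (a + 2 * (δ / 3)) D hφ' fun y hy =>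
      hD y ⟨by linarith [hy.1], by linarith [hy.2]⟩
    have hxy : δ / 3 ≤ y - x := by linarith [hx.2, hy.1]
    have hdiff : Differentiable ℝ (iteratedDeriv s φ) :=
      hφ.differentiable_iteratedDeriv s (by exact_mod_cast Nat.lt_succ_self s)
    obtain ⟨ξ, hξ, hξ'⟩ := exists_deriv_eq_slope (iteratedDeriv s φ)
      (show x < y by linarith) hdiff.continuous.continuousOn hdiff.differentiableOn
    refine ⟨ξ, ⟨by linarith [hξ.1, hx.1], by linarith [hξ.2, hy.2]⟩, ?_⟩
    rw [iteratedDeriv_succ, hξ', abs_div, abs_of_pos (show 0 < y - x by linarith)]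
    have h1 : |iteratedDeriv s φ y - iteratedDeriv s φ x| ≤ 2 * c * D := by
      have := abs_sub (iteratedDeriv s φ y) (iteratedDeriv s φ x)
      linarith
    calc _ ≤ 2 * c * D / (y - x) := by gcongr; linarith
      _ ≤ 2 * c * D / (δ / 3) := by
          have : 0 ≤ 2 * c * D := (abs_nonneg _).trans h1
          gcongr
      _ = _ := by ring

section Line
variable {E : Type*} [NormedAddCommGroup E] [NormedSpace ℝ E]

theorem iteratedDeriv_comp_line {f : E → ℝ} (q v : E) (n : ℕ) (hf : ContDiff ℝ n f) :
    iteratedDeriv n (fun t : ℝ => f (q + t • v)) =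
      fun t => iteratedFDeriv ℝ n f (q + t • v) fun _ => v := by
  induction n with
  | zero => ext t; simp
  | succ n ih =>
    rw [iteratedDeriv_succ, ih (hf.of_le (by exact_mod_cast Nat.le_succ n))]
    ext t
    have hd : DifferentiableAt ℝ (iteratedFDeriv ℝ n f) (q + t • v) :=
      hf.differentiable_iteratedFDeriv (by exact_mod_cast Nat.lt_succ_self n) _
    have hl : HasDerivAt (fun t : ℝ => q + t • v) v t := by
      simpa using ((hasDerivAt_id t).smul_const v).const_add q
    have h1 := hd.hasFDerivAt.comp_hasDerivAt t hl
    have h2 := (ContinuousMultilinearMap.apply ℝ (fun _ : Fin n => E) ℝ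
      (fun _ => v)).hasFDerivAt.comp_hasDerivAt t h1
    rw [iteratedFDeriv_succ_apply_left]
    exact h2.deriv

/-- A bounded function with uniformly continuous `s`-th derivative has bounded `s`-th derivative
(along the diagonal). -/
theorem exists_abs_iteratedFDeriv_diag_le {f : E → ℝ} {s : ℕ} (hs : 1 ≤ s) (hf : ContDiff ℝ s f)
    (huc : UniformContinuous (iteratedFDeriv ℝ s f)) {D : ℝ} (hD : ∀ x, |f x| ≤ D) :
    ∃ B : ℝ, 0 ≤ B ∧ ∀ x v : E, |iteratedFDeriv ℝ s f x fun _ => v| ≤ B * ‖v‖ ^ s := by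
  obtain ⟨δ, hδ, H⟩ := Metric.uniformContinuous_iff.1 huc 1 one_pos
  obtain ⟨c, hc, Hc⟩ := exists_abs_iteratedDeriv_le s (δ / 2) (by positivity)
  have hD0 : 0 ≤ D := (abs_nonneg _).trans (hD 0)
  have key : ∀ x u : E, ‖u‖ = 1 → |iteratedFDeriv ℝ s f x fun _ => u| ≤ c * D + 1 := by
    intro x u hu
    -- Some point of the segment of length `δ / 2` has derivative at most `c * D`; uniform
    -- continuity carries this back to `x` at the cost of 1.
    obtain ⟨ξ, hξ, hb⟩ := Hc (fun t => f (x + t • u)) 0 D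
      (hf.comp (contDiff_const.add (contDiff_id.smul contDiff_const))) fun y _ => hD _
    rw [iteratedDeriv_comp_line x u s hf] at hb
    have hdist : dist x (x + ξ • u) < δ := by
      rw [dist_self_add_right, norm_smul, hu, mul_one, Real.norm_eq_abs, abs_of_nonneg hξ.1]
      linarith [hξ.2]
    have h1 := (H hdist).le
    rw [dist_eq_norm] at h1
    have h2 := (iteratedFDeriv ℝ s f x - iteratedFDeriv ℝ s f (x + ξ • u)).le_opNorm fun _ => u
    simp only [hu, Finset.prod_const_one, mul_one, sub_apply,
      Real.norm_eq_abs] at h2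
    have h3 := abs_sub_abs_le_abs_sub (iteratedFDeriv ℝ s f x fun _ => u)
      (iteratedFDeriv ℝ s f (x + ξ • u) fun _ => u)
    simp only at hb
    linarith
  refine ⟨c * D + 1, by positivity, fun x v => ?_⟩
  rcases eq_or_ne v 0 with rfl | hv
  · have : Nonempty (Fin s) := ⟨⟨0, hs⟩⟩
    rw [show (fun _ : Fin s => (0 : E)) = 0 from rfl, ContinuousMultilinearMap.map_zero]
    simp [show s ≠ 0 by lia]
  · have hv' : ‖v‖ ≠ 0 := norm_ne_zero_iff.2 hv
    have hvv : v = ‖v‖ • (‖v‖⁻¹ • v) := by rw [smul_smul, mul_inv_cancel₀ hv', one_smul]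
    have h1 := key x (‖v‖⁻¹ • v) (by rw [norm_smul, norm_inv, norm_norm, inv_mul_cancel₀ hv'])
    have h2 : (iteratedFDeriv ℝ s f x fun _ => v) =
        ‖v‖ ^ s * iteratedFDeriv ℝ s f x fun _ => ‖v‖⁻¹ • v := by
      conv_lhs => rw [hvv]
      rw [ContinuousMultilinearMap.map_smul_univ (iteratedFDeriv ℝ s f x) (fun _ => ‖v‖)
        (fun _ => ‖v‖⁻¹ • v)]
      simp
    rw [h2, abs_mul, abs_of_nonneg (by positivity : 0 ≤ ‖v‖ ^ s), mul_comm]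
    gcongr

theorem exists_taylor_line {f : E → ℝ} {s : ℕ} (hf : ContDiff ℝ (s + 1 : ℕ) f) (q v : E) :
    ∃ ξ : ℝ, f (q + v) = ∑ j ∈ Finset.range (s + 1),
        ((j.factorial : ℝ)⁻¹) * (iteratedFDeriv ℝ j f q fun _ => v) +
      (iteratedFDeriv ℝ (s + 1) f (q + ξ • v) fun _ => v) / (s + 1).factorial := by
  have hφ : ContDiff ℝ (s + 1 : ℕ) fun t : ℝ => f (q + t • v) :=
    hf.comp (contDiff_const.add (contDiff_id.smul contDiff_const))
  -- The position of `ξ` is dropped: the derivative bound used later is global.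
  obtain ⟨ξ, -, h⟩ := taylor_mean_remainder_lagrange_iteratedDeriv (n := s)
    (zero_ne_one' ℝ) hφ.contDiffOn
  refine ⟨ξ, ?_⟩
  rw [iteratedDeriv_comp_line q v _ hf, taylor_within_apply] at h
  simp only [sub_zero, one_pow, mul_one, one_smul, smul_eq_mul] at h
  rw [← sub_eq_iff_eq_add', ← h]
  congr 1
  refine Finset.sum_congr rfl fun j hj => ?_
  have hj' : j ≤ s + 1 := (Finset.mem_range.1 hj).le
  have hu : UniqueDiffOn ℝ (Set.uIcc (0 : ℝ) 1) := by
    rw [Set.uIcc_of_le zero_le_one]; exact uniqueDiffOn_Icc zero_lt_one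
  rw [iteratedDerivWithin_eq_iteratedDeriv hu
    ((hφ.of_le (by exact_mod_cast hj')).contDiffAt) (by simp),
    iteratedDeriv_comp_line q v j (hf.of_le (by exact_mod_cast hj'))]
  simp

end Line

/-! ### Moments of the kernel and the bias -/

section Kernel
variable {m : ℕ}

/-- Translates the monomial moment conditions into conditions on the derivatives in Taylor's
formula. The exponent of `u i` is the size of the fibre of `r` over `i`. -/
theorem multilinear_diag_eq_sum_monomials {j : ℕ}
    (g : ContinuousMultilinearMap ℝ (fun _ : Fin j => EuclideanSpace ℝ (Fin m)) ℝ)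
    (u : EuclideanSpace ℝ (Fin m)) :
    (g fun _ => u) = ∑ r : Fin j → Fin m,
      (∏ i, u i ^ (Finset.univ.filter fun k => r k = i).card) *
        g fun k => EuclideanSpace.single (r k) (1 : ℝ) := by
  have hu : u = ∑ i, u i • EuclideanSpace.single i (1 : ℝ) := by
    ext i
    simp [Finset.sum_apply, Pi.single_apply]
  conv_lhs => rw [hu]
  rw [g.map_sum]
  refine Finset.sum_congr rfl fun r _ => ?_
  rw [g.map_smul_univ (fun k => u (r k)) fun k => EuclideanSpace.single (r k) (1 : ℝ),
    smul_eq_mul]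
  congr 1
  rw [← Finset.prod_fiberwise' Finset.univ r fun i => u i]
  simp

namespace IsKernelOfOrder
variable {s : ℕ} {K : EuclideanSpace ℝ (Fin m) → ℝ}

/-- Interpolation: `‖u‖ ^ j ≤ 1 + ‖u‖ ^ s`. -/
theorem integrable_norm_pow_mul (hK : IsKernelOfOrder s K) {j : ℕ} (hj : j ≤ s) :
    Integrable fun u => ‖u‖ ^ j * K u := by
  refine (hK.integrable.norm.add hK.integrable_moment.norm).mono'
    ((by fun_prop : Continuous fun u : EuclideanSpace ℝ (Fin m) =>
      ‖u‖ ^ j).aestronglyMeasurable.mul hK.integrable.aestronglyMeasurable)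
    (ae_of_all _ fun u => ?_)
  simp only [norm_mul, norm_pow, norm_norm, Pi.add_apply]
  rw [← one_add_mul]
  gcongr
  rcases le_total ‖u‖ 1 with h | h
  · exact (pow_le_one₀ (norm_nonneg _) h).trans (by simp)
  · exact (pow_le_pow_right₀ h hj).trans (by simp)

theorem integrable_of_abs_le (hK : IsKernelOfOrder s K) {j : ℕ} (hj : j ≤ s)
    {p : EuclideanSpace ℝ (Fin m) → ℝ} (hp : Continuous p) {c : ℝ}
    (hpc : ∀ u, |p u| ≤ c * ‖u‖ ^ j) : Integrable fun u => p u * K u := by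
  refine ((hK.integrable_norm_pow_mul hj).norm.const_mul c).mono'
    (hp.aestronglyMeasurable.mul hK.integrable.aestronglyMeasurable) (ae_of_all _ fun u => ?_)
  rw [norm_mul, norm_mul, ← mul_assoc]
  gcongr
  simpa using hpc u

theorem integral_multilinear_diag_eq_zero (hK : IsKernelOfOrder s K) {j : ℕ} (h1 : 1 ≤ j)
    (hj : j < s) (g : ContinuousMultilinearMap ℝ
      (fun _ : Fin j => EuclideanSpace ℝ (Fin m)) ℝ) :
    ∫ u, (g fun _ => u) * K u = 0 := by
  have hcard : ∀ r : Fin j → Fin m,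
      ∑ i, (Finset.univ.filter fun k => r k = i).card = j := fun r => by
    rw [← Finset.card_eq_sum_card_fiberwise fun _ _ => Finset.mem_univ _]
    simp
  simp_rw [multilinear_diag_eq_sum_monomials g, Finset.sum_mul]
  rw [integral_finsetSum]
  · refine Finset.sum_eq_zero fun r _ => ?_
    simp_rw [mul_right_comm]
    rw [integral_mul_const, hK.moment_eq_zero _ (by rw [hcard]; exact h1)
      (by rw [hcard]; exact hj), zero_mul]
  · intro r _
    simp_rw [mul_right_comm]
    refine Integrable.mul_const (hK.integrable_of_abs_le hj.le (by fun_prop) (c := 1)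
      fun u => ?_) _
    rw [Finset.abs_prod, one_mul]
    calc _ ≤ ∏ i, ‖u‖ ^ (Finset.univ.filter fun k => r k = i).card := by
          refine Finset.prod_le_prod (fun _ _ => abs_nonneg _) fun i _ => ?_
          rw [abs_pow]
          gcongr
          exact PiLp.norm_apply_le u i
      _ = ‖u‖ ^ j := by rw [Finset.prod_pow_eq_pow_sum, hcard]

/-- The bias of smoothing with a kernel of order `s` is of order `h ^ s`. -/
theorem exists_abs_integral_sub_le (hK : IsKernelOfOrder s K) (hs : 1 ≤ s)
    {f : EuclideanSpace ℝ (Fin m) → ℝ} (hf : ContDiff ℝ s f)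
    (huc : UniformContinuous (iteratedFDeriv ℝ s f)) {D : ℝ} (hD : ∀ x, |f x| ≤ D) :
    ∃ C : ℝ, 0 ≤ C ∧ ∀ (h : ℝ), 0 < h → ∀ q,
      |(∫ u, f (q - h • u) * K u) - f q| ≤ C * h ^ s := by
  obtain ⟨B, hB, hBf⟩ := exists_abs_iteratedFDeriv_diag_le hs hf huc hD
  obtain ⟨s, rfl⟩ : ∃ t, s = t + 1 := ⟨s - 1, by lia⟩
  have hI0 : 0 ≤ ∫ u, ‖‖u‖ ^ (s + 1) * K u‖ := integral_nonneg fun _ => norm_nonneg _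
  refine ⟨B * ∫ u, ‖‖u‖ ^ (s + 1) * K u‖, by positivity, fun h hh q => ?_⟩
  -- The Taylor polynomial of `f (q - h • u)` in `u`; against `K` only its constant term survives.
  let T : EuclideanSpace ℝ (Fin m) → ℝ := fun u => ∑ j ∈ Finset.range (s + 1),
    ((j.factorial : ℝ)⁻¹) * ((-h) ^ j * iteratedFDeriv ℝ j f q fun _ => u)
  have hTi : ∀ j ∈ Finset.range (s + 1), Integrable fun u =>
      ((j.factorial : ℝ)⁻¹) * ((-h) ^ j * iteratedFDeriv ℝ j f q fun _ => u) * K u := by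
    intro j hj
    simp_rw [mul_assoc]
    refine Integrable.const_mul (Integrable.const_mul ?_ _) _
    refine hK.integrable_of_abs_le (Finset.mem_range.1 hj).le
      ((iteratedFDeriv ℝ j f q).cont.comp (by fun_prop)) (c := ‖iteratedFDeriv ℝ j f q‖)
      fun u => ?_
    simpa using (iteratedFDeriv ℝ j f q).le_opNorm fun _ => u
  have hTK : Integrable fun u => T u * K u := by
    simp only [T, Finset.sum_mul]
    exact integrable_finsetSum _ hTi
  have hTint : ∫ u, T u * K u = f q := by
    simp only [T, Finset.sum_mul]
    rw [integral_finsetSum _ hTi, Finset.sum_range_succ', Finset.sum_eq_zero, zero_add]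
    · simp [integral_const_mul, hK.integral_eq_one]
    · intro j hj
      simp_rw [mul_assoc]
      rw [integral_const_mul, integral_const_mul,
        hK.integral_multilinear_diag_eq_zero (by lia)
          (by have := Finset.mem_range.1 hj; lia), mul_zero, mul_zero]
  have hfK : Integrable fun u => f (q - h • u) * K u := by
    refine hK.integrable_of_abs_le (Nat.zero_le _) (hf.continuous.comp (by fun_prop)) (c := D)
      fun u => ?_
    simpa using hD _
  rw [← hTint, ← integral_sub hfK hTK]
  have hbound : ∀ u, ‖f (q - h • u) * K u - T u * K u‖ ≤
      B * h ^ (s + 1) * ‖‖u‖ ^ (s + 1) * K u‖ := by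
    intro u
    obtain ⟨ξ, hξ⟩ := exists_taylor_line hf q (-(h • u))
    have hT : f (q - h • u) - T u =
        (iteratedFDeriv ℝ (s + 1) f (q + ξ • (-(h • u))) fun _ => -(h • u)) /
          (s + 1).factorial := by
      rw [sub_eq_iff_eq_add', sub_eq_add_neg q, hξ]
      congr 1
      refine Finset.sum_congr rfl fun j _ => ?_
      rw [show -(h • u) = (-h) • u by simp, (iteratedFDeriv ℝ j f q).map_smul_univ
        (fun _ => -h) fun _ => u]
      simp
    rw [← sub_mul, hT, norm_mul, norm_mul, norm_pow, norm_norm, ← mul_assoc]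
    gcongr
    have h2 := hBf (q + ξ • (-(h • u))) (-(h • u))
    rw [norm_neg, norm_smul, Real.norm_eq_abs, abs_of_pos hh, mul_pow, ← mul_assoc] at h2
    rw [norm_div, Real.norm_eq_abs]
    refine (div_le_self (abs_nonneg _) ?_).trans h2
    simp [Nat.one_le_cast, Nat.one_le_iff_ne_zero, Nat.factorial_ne_zero]
  calc _ ≤ ∫ u, B * h ^ (s + 1) * ‖‖u‖ ^ (s + 1) * K u‖ :=
        norm_integral_le_of_norm_le (hK.integrable_moment.norm.const_mul _) (ae_of_all _ hbound)
    _ = _ := by rw [integral_const_mul]; ring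

end IsKernelOfOrder
end Kernel

/-! ### Boundedness of the density -/

/-- A uniformly continuous nonnegative integrable function is bounded. -/
theorem UniformContinuous.exists_le_of_lintegral_ne_top {E : Type*} [NormedAddCommGroup E]
    [MeasurableSpace E] [BorelSpace E] {μ : Measure E} [μ.IsAddHaarMeasure] {f : E → ℝ}
    (hf : UniformContinuous f) (hint : ∫⁻ x, ENNReal.ofReal (f x) ∂μ ≠ ∞) :
    ∃ D : ℝ, ∀ x, f x ≤ D := by
  obtain ⟨δ, hδ, H⟩ := Metric.uniformContinuous_iff.1 hf 1 one_pos
  set I := ∫⁻ x, ENNReal.ofReal (f x) ∂μ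
  have hv : μ (Metric.ball 0 δ) ≠ 0 := (Metric.measure_ball_pos μ 0 hδ).ne'
  have hI : I / μ (Metric.ball 0 δ) ≠ ∞ := ENNReal.div_ne_top hint hv
  -- On the `δ`-ball around `x` the function exceeds `f x - 1`, so `f x - 1` times the volume of the
  -- ball is at most `I`.
  refine ⟨(I / μ (Metric.ball 0 δ)).toReal + 1, fun x => ?_⟩
  rw [← sub_le_iff_le_add]
  refine (ENNReal.ofReal_le_iff_le_toReal hI).1 ?_
  refine ENNReal.le_div_iff_mul_le (.inl hv) (.inr hint) |>.2 ?_
  rw [← Measure.addHaar_ball_center μ x, ← setLIntegral_const]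
  calc _ ≤ ∫⁻ y in Metric.ball x δ, ENNReal.ofReal (f y) ∂μ := by
        refine setLIntegral_mono' measurableSet_ball fun y hy => ENNReal.ofReal_le_ofReal ?_
        have := H (Metric.mem_ball.1 hy)
        rw [Real.dist_eq, abs_lt] at this
        linarith
    _ ≤ _ := setLIntegral_le_lintegral _ _

/-! ### Exponential moments of centered sums -/

section Concentration
variable {Ω : Type*} [MeasurableSpace Ω] {Pr : Measure Ω} [IsProbabilityMeasure Pr]

/-- Bernstein's argument: `exp y ≤ 1 + y + y ^ 2` for `|y| ≤ 1`, the linear term has mean zero, and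
the variance is at most the second moment. Centering doubles the bound `b`. -/
theorem mgf_sub_integral_le {ξ : Ω → ℝ} (hξ : Measurable ξ) {b t : ℝ} (hb : ∀ ω, |ξ ω| ≤ b)
    (ht : |t| * (2 * b) ≤ 1) :
    mgf (fun ω => ξ ω - ∫ ω, ξ ω ∂Pr) Pr t ≤ Real.exp (t ^ 2 * ∫ ω, ξ ω ^ 2 ∂Pr) := by
  set c := ∫ ω, ξ ω ∂Pr with hc
  have hξm : MemLp ξ 2 Pr := MemLp.of_bound hξ.aestronglyMeasurable b (ae_of_all _ hb)
  have hξi : Integrable ξ Pr := hξm.integrable one_le_two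
  have hcb : |c| ≤ b := by
    have := norm_integral_le_of_norm_le_const (μ := Pr) (f := ξ) (ae_of_all _ hb)
    simpa using this
  have hηm : MemLp (fun ω => ξ ω - c) 2 Pr := hξm.sub (memLp_const c)
  have hη : ∀ ω, |t * (ξ ω - c)| ≤ 1 := fun ω => by
    rw [abs_mul]
    refine le_trans ?_ ht
    gcongr
    have := abs_sub (ξ ω) c
    linarith [hb ω]
  have hpt : ∀ ω, Real.exp (t * (ξ ω - c)) ≤ 1 + t * (ξ ω - c) + t ^ 2 * (ξ ω - c) ^ 2 :=
    fun ω => by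
    have := le_of_abs_le (Real.abs_exp_sub_one_sub_id_le (hη ω))
    rw [mul_pow] at this
    linarith
  have hi1 : Integrable (fun ω => t * (ξ ω - c)) Pr := (hξi.sub (integrable_const c)).const_mul t
  have hi2 : Integrable (fun ω => t ^ 2 * (ξ ω - c) ^ 2) Pr := hηm.integrable_sq.const_mul _
  have hi12 : Integrable (fun ω => 1 + t * (ξ ω - c)) Pr := (integrable_const 1).add hi1
  have hvar : ∫ ω, (ξ ω - c) ^ 2 ∂Pr ≤ ∫ ω, ξ ω ^ 2 ∂Pr := by
    have h1 := variance_le_expectation_sq (μ := Pr) hξ.aestronglyMeasurable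
    rwa [variance_eq_integral hξ.aemeasurable] at h1
  calc mgf (fun ω => ξ ω - c) Pr t
      ≤ ∫ ω, (1 + t * (ξ ω - c) + t ^ 2 * (ξ ω - c) ^ 2) ∂Pr := by
        refine integral_mono_of_nonneg (ae_of_all _ fun _ => (Real.exp_pos _).le)
          (hi12.add hi2) (ae_of_all _ hpt)
    _ = 1 + t ^ 2 * ∫ ω, (ξ ω - c) ^ 2 ∂Pr := by
        rw [integral_add hi12 hi2,
          integral_add (integrable_const 1) hi1, integral_const_mul, integral_const_mul,
          integral_sub hξi (integrable_const c)]
        simp [← hc]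
    _ ≤ 1 + t ^ 2 * ∫ ω, ξ ω ^ 2 ∂Pr := by gcongr
    _ ≤ _ := by rw [add_comm]; exact Real.add_one_le_exp _

variable {E : Type*} [MeasurableSpace E] {ν : Measure E}
  {X : ℕ → Ω → E}

theorem mgf_sum_sub_integral_le (hX : ∀ i, Measurable (X i)) (hlaw : ∀ i, HasLaw (X i) ν Pr)
    (hind : iIndepFun X Pr) {g : E → ℝ} (hg : Measurable g) {b t : ℝ} (hb : ∀ x, |g x| ≤ b)
    (ht : |t| * (2 * b) ≤ 1) (M : ℕ) :
    mgf (fun ω => ∑ i ∈ Finset.range M, (g (X i ω) - ∫ x, g x ∂ν)) Pr t ≤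
      Real.exp (M * t ^ 2 * ∫ x, g x ^ 2 ∂ν) := by
  have h1 := (hind.comp (fun _ x => g x - ∫ x, g x ∂ν)
    fun _ => hg.sub_const _).mgf_sum (t := t) (fun i => (hg.sub_const _).comp (hX i))
    (Finset.range M)
  have h2 : (∑ i ∈ Finset.range M, (fun x => g x - ∫ x, g x ∂ν) ∘ X i) =
      fun ω => ∑ i ∈ Finset.range M, (g (X i ω) - ∫ x, g x ∂ν) := by
    ext ω; simp [Finset.sum_apply]
  rw [← h2, h1]
  calc _ ≤ ∏ _i ∈ Finset.range M, Real.exp (t ^ 2 * ∫ x, g x ^ 2 ∂ν) := by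
        refine Finset.prod_le_prod (fun _ _ => mgf_nonneg) fun i _ => ?_
        have e1 : ∫ ω, g (X i ω) ∂Pr = ∫ x, g x ∂ν :=
          (hlaw i).integral_comp hg.aestronglyMeasurable
        have e2 : ∫ ω, g (X i ω) ^ 2 ∂Pr = ∫ x, g x ^ 2 ∂ν :=
          (hlaw i).integral_comp (f := fun x => g x ^ 2) (hg.pow_const 2).aestronglyMeasurable
        have := mgf_sub_integral_le (Pr := Pr) (hg.comp (hX i)) (fun ω => hb (X i ω)) ht
        simp only [Function.comp_apply, e1, e2] at this
        exact this
    _ = _ := by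
        rw [Finset.prod_const, Finset.card_range, ← Real.exp_nat_mul]; ring_nf

/-- Averages the bounds at `t` and `-t`. Subtracting 1 makes the right side vanish with the second
moment of `g`, as integration over an infinite measure requires. -/
theorem lintegral_cosh_sum_sub_integral_le (hX : ∀ i, Measurable (X i))
    (hlaw : ∀ i, HasLaw (X i) ν Pr) (hind : iIndepFun X Pr) {g : E → ℝ} (hg : Measurable g)
    {b t : ℝ} (hb : ∀ x, |g x| ≤ b) (ht : |t| * (2 * b) ≤ 1) (M : ℕ) :
    ∫⁻ ω, ENNReal.ofReal
        (Real.cosh (t * ∑ i ∈ Finset.range M, (g (X i ω) - ∫ x, g x ∂ν)) - 1) ∂Pr ≤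
      ENNReal.ofReal (Real.exp (M * t ^ 2 * ∫ x, g x ^ 2 ∂ν) - 1) := by
  set S : Ω → ℝ := fun ω => ∑ i ∈ Finset.range M, (g (X i ω) - ∫ x, g x ∂ν) with hS
  have hSm : Measurable S := Finset.measurable_fun_sum _ fun i _ =>
    (hg.comp (hX i)).sub_const _
  have hSb : ∃ B, ∀ ω, |S ω| ≤ B := ⟨∑ i ∈ Finset.range M, (b + |∫ x, g x ∂ν|), fun ω =>
    (Finset.abs_sum_le_sum_abs _ _).trans (Finset.sum_le_sum fun i _ =>
      (abs_sub _ _).trans (by gcongr; exact hb _))⟩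
  obtain ⟨B, hB⟩ := hSb
  have hint : ∀ t : ℝ, Integrable (fun ω => Real.exp (t * S ω)) Pr := fun t =>
    Integrable.of_bound (by fun_prop) (Real.exp (|t| * B)) (ae_of_all _ fun ω => by
      rw [Real.norm_eq_abs, Real.abs_exp]
      refine Real.exp_le_exp.2 ((le_abs_self _).trans ?_)
      rw [abs_mul]
      gcongr
      exact hB ω)
  have hcosh : ∀ ω, Real.cosh (t * S ω) =
      2⁻¹ * (Real.exp (t * S ω) + Real.exp (-t * S ω)) := fun ω => by
    rw [Real.cosh_eq, neg_mul]; ring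
  have hci : Integrable (fun ω => Real.cosh (t * S ω)) Pr := by
    simp_rw [hcosh]
    exact ((hint t).add (hint (-t))).const_mul _
  have hci1 : Integrable (fun ω => Real.cosh (t * S ω) - 1) Pr := hci.sub (integrable_const 1)
  change ∫⁻ ω, ENNReal.ofReal (Real.cosh (t * S ω) - 1) ∂Pr ≤ _
  rw [← ofReal_integral_eq_lintegral_ofReal hci1
    (ae_of_all _ fun ω => sub_nonneg.2 (Real.one_le_cosh _))]
  refine ENNReal.ofReal_le_ofReal ?_
  rw [integral_sub hci (integrable_const 1)]
  simp_rw [hcosh]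
  rw [integral_const_mul, integral_add (hint t) (hint (-t))]
  have h1 := mgf_sum_sub_integral_le hX hlaw hind hg hb ht M
  have h2 := mgf_sum_sub_integral_le hX hlaw hind hg hb (t := -t) (by rwa [abs_neg]) M
  rw [neg_sq] at h2
  simp only [mgf] at h1 h2
  simp only [integral_const, probReal_univ, smul_eq_mul, mul_one]
  linarith

variable [IsProbabilityMeasure ν] {F : Type*} [MeasurableSpace F] {ρ : Measure F} [SFinite ρ]

/-- By `exp y - 1 ≤ y * exp y`, one factor stays linear in the second moment and can be integrated
over `q`; the uniform bound `V` enters only the exponent. -/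
theorem lintegral_lintegral_cosh_le (hX : ∀ i, Measurable (X i))
    (hlaw : ∀ i, HasLaw (X i) ν Pr) (hind : iIndepFun X Pr) {g : F → E → ℝ}
    (hg : Measurable (Function.uncurry g)) {b t V : ℝ} (hb : ∀ q x, |g q x| ≤ b)
    (ht : |t| * (2 * b) ≤ 1) (M : ℕ) (hV : ∀ q, ∫ x, g q x ^ 2 ∂ν ≤ V) :
    ∫⁻ ω, ∫⁻ q, ENNReal.ofReal
        (Real.cosh (t * ∑ i ∈ Finset.range M, (g q (X i ω) - ∫ x, g q x ∂ν)) - 1) ∂ρ ∂Pr ≤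
      ENNReal.ofReal (M * t ^ 2 * Real.exp (M * t ^ 2 * V)) *
        ∫⁻ q, ENNReal.ofReal (∫ x, g q x ^ 2 ∂ν) ∂ρ := by
  have hmean : Measurable fun q => ∫ x, g q x ∂ν :=
    (hg.stronglyMeasurable.integral_prod_right (ν := ν)).measurable
  rw [lintegral_lintegral_swap]
  · rw [← lintegral_const_mul' _ _ ENNReal.ofReal_ne_top]
    refine lintegral_mono fun q => ?_
    refine (lintegral_cosh_sum_sub_integral_le hX hlaw hind
      (hg.comp measurable_prodMk_left : Measurable (g q)) (hb q) ht M).trans ?_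
    have hv0 : 0 ≤ ∫ x, g q x ^ 2 ∂ν := integral_nonneg fun _ => sq_nonneg _
    rw [← ENNReal.ofReal_mul (by positivity)]
    refine ENNReal.ofReal_le_ofReal ?_
    set y := M * t ^ 2 * ∫ x, g q x ^ 2 ∂ν with hy
    have hexp : Real.exp y - 1 ≤ y * Real.exp y := by
      have h1 := Real.add_one_le_exp (-y)
      have h2 : Real.exp (-y) * Real.exp y = 1 := by rw [← Real.exp_add]; simp
      nlinarith [Real.exp_pos y]
    refine hexp.trans ?_
    have hyV : y ≤ M * t ^ 2 * V := by rw [hy]; gcongr; exact hV q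
    calc y * Real.exp y ≤ y * Real.exp (M * t ^ 2 * V) := by
          have : 0 ≤ y := by positivity
          gcongr
      _ = _ := by rw [hy]; ring
  · refine Measurable.aemeasurable ?_
    refine ENNReal.measurable_ofReal.comp (Measurable.sub_const (Real.measurable_cosh.comp
      (Measurable.const_mul (Finset.measurable_fun_sum _ fun i _ => ?_) t)) 1)
    exact (hg.comp (measurable_snd.prodMk ((hX i).comp measurable_fst))).sub
      (hmean.comp measurable_snd)

end Concentration

/-! ### Maximal inequality over the whole space -/

section Sup
variable {E : Type*} [NormedAddCommGroup E] [MeasurableSpace E] [BorelSpace E]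
  {μ : Measure E} [μ.IsAddHaarMeasure]

/-- A Lipschitz function that is large at a point is large on a ball, hence its exponential
integral is large. -/
theorem le_lintegral_cosh_of_lipschitz {Z : E → ℝ} {l r t : ℝ} (hl : 0 < l) (hr : 0 ≤ r)
    (ht : 0 ≤ t) (hZ : ∀ q q', |Z q - Z q'| ≤ l * ‖q - q'‖) {q₀ : E} (hq : r ≤ |Z q₀|) :
    ENNReal.ofReal (Real.cosh (t * (r / 2)) - 1) * μ (Metric.ball 0 (r / (2 * l))) ≤
      ∫⁻ q, ENNReal.ofReal (Real.cosh (t * Z q) - 1) ∂μ := by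
  rw [← Measure.addHaar_ball_center μ q₀, ← setLIntegral_const]
  refine (setLIntegral_mono' measurableSet_ball fun y hy => ?_).trans
    (setLIntegral_le_lintegral _ _)
  refine ENNReal.ofReal_le_ofReal (sub_le_sub_right ?_ 1)
  rw [Real.cosh_le_cosh, abs_mul, abs_mul, abs_of_nonneg ht,
    abs_of_nonneg (by positivity : 0 ≤ r / 2)]
  gcongr
  have h1 := hZ q₀ y
  have h2 : l * ‖q₀ - y‖ ≤ r / 2 := by
    rw [Metric.mem_ball, dist_comm, dist_eq_norm] at hy
    calc _ ≤ l * (r / (2 * l)) := by gcongr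
      _ = r / 2 := by field_simp
  have h3 := abs_sub_abs_le_abs_sub (Z q₀) (Z y)
  linarith

variable {Ω : Type*} [MeasurableSpace Ω] {Pr : Measure Ω} [IsProbabilityMeasure Pr]
  {G : Type*} [MeasurableSpace G] {ν : Measure G} [IsProbabilityMeasure ν]
  {X : ℕ → Ω → G}
  [ProperSpace E]

/-- A maximal inequality for the centered sums of a Lipschitz family of bounded functions, over
the whole (unbounded) parameter space. -/
theorem measure_exists_le_abs_sum_le (hX : ∀ i, Measurable (X i))
    (hlaw : ∀ i, HasLaw (X i) ν Pr) (hind : iIndepFun X Pr) {g : E → G → ℝ}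
    (hg : Measurable (Function.uncurry g)) {b t V l r : ℝ} (hb : ∀ q x, |g q x| ≤ b)
    (ht0 : 0 < t) (ht : t * (2 * b) ≤ 1) (M : ℕ) (hV : ∀ q, ∫ x, g q x ^ 2 ∂ν ≤ V)
    (hl : 0 < l) (hr : 0 < r) (hlip : ∀ x q q', |g q x - g q' x| ≤ l * ‖q - q'‖) (hM : 0 < M) :
    Pr {ω | ∃ q, r ≤ |∑ i ∈ Finset.range M, (g q (X i ω) - ∫ x, g q x ∂ν)|} ≤
      (ENNReal.ofReal (M * t ^ 2 * Real.exp (M * t ^ 2 * V)) *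
        ∫⁻ q, ENNReal.ofReal (∫ x, g q x ^ 2 ∂ν) ∂μ) /
      (ENNReal.ofReal (Real.cosh (t * (r / 2)) - 1) *
        μ (Metric.ball 0 (r / (2 * (M * (2 * l)))))) := by
  have hM' : (0 : ℝ) < M := by exact_mod_cast hM
  have hgi : ∀ q, Integrable (g q) ν := fun q => Integrable.of_bound
    (hg.comp measurable_prodMk_left : Measurable (g q)).aestronglyMeasurable b
    (ae_of_all _ (hb q))
  have hmean : ∀ q q', |(∫ x, g q x ∂ν) - ∫ x, g q' x ∂ν| ≤ l * ‖q - q'‖ := fun q q' => by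
    rw [← integral_sub (hgi q) (hgi q')]
    simpa using norm_integral_le_of_norm_le_const (μ := ν)
      (f := fun x => g q x - g q' x) (ae_of_all _ fun x => hlip x q q')
  have hmeas : Measurable fun ω => ∫⁻ q, ENNReal.ofReal
      (Real.cosh (t * ∑ i ∈ Finset.range M, (g q (X i ω) - ∫ x, g q x ∂ν)) - 1) ∂μ := by
    have hmean : Measurable fun q => ∫ x, g q x ∂ν :=
      (hg.stronglyMeasurable.integral_prod_right (ν := ν)).measurable
    refine Measurable.lintegral_prod_right' (f := fun p : Ω × E => ENNReal.ofReal
      (Real.cosh (t * ∑ i ∈ Finset.range M, (g p.2 (X i p.1) - ∫ x, g p.2 x ∂ν)) - 1)) ?_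
    refine ENNReal.measurable_ofReal.comp (Measurable.sub_const (Real.measurable_cosh.comp
      (Measurable.const_mul (Finset.measurable_fun_sum _ fun i _ => ?_) t)) 1)
    exact (hg.comp (measurable_snd.prodMk ((hX i).comp measurable_fst))).sub
      (hmean.comp measurable_snd)
  have hc0 : ENNReal.ofReal (Real.cosh (t * (r / 2)) - 1) *
      μ (Metric.ball 0 (r / (2 * (M * (2 * l))))) ≠ 0 := by
    refine mul_ne_zero ?_ (Metric.measure_ball_pos μ 0 (by positivity)).ne'
    rw [Ne, ENNReal.ofReal_eq_zero, not_le, sub_pos]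
    exact Real.one_lt_cosh.2 (by positivity)
  -- The event need not be measurable: it lies in a superlevel set of the integral, to which
  -- Markov's inequality applies.
  refine (measure_mono ?_).trans ((meas_ge_le_lintegral_div hmeas.aemeasurable hc0 ?_).trans
    (ENNReal.div_le_div_right (lintegral_lintegral_cosh_le hX hlaw hind hg hb
      (by rwa [abs_of_pos ht0]) M hV) _))
  · rintro ω ⟨q, hq⟩
    -- The sum has Lipschitz constant `M * (2 * l)`: each summand and its mean contribute `l`.
    refine le_lintegral_cosh_of_lipschitz (by positivity) hr.le ht0.le (fun q q' => ?_) hq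
    rw [← Finset.sum_sub_distrib]
    refine (Finset.abs_sum_le_sum_abs _ _).trans ?_
    calc _ ≤ ∑ i ∈ Finset.range M, 2 * l * ‖q - q'‖ := by
          refine Finset.sum_le_sum fun i _ => ?_
          rw [sub_sub_sub_comm]
          refine (abs_sub _ _).trans ?_
          linarith [hlip (X i ω) q q', hmean q q']
      _ = _ := by simp; ring
  · exact ENNReal.mul_ne_top ENNReal.ofReal_ne_top measure_ball_lt_top.ne

end Sup

/-! ### Kernel sums at bandwidth `h` and their tails -/

section Smoothing
variable {m : ℕ} {K : EuclideanSpace ℝ (Fin m) → ℝ}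

theorem integral_comp_inv_smul_sub {G : EuclideanSpace ℝ (Fin m) → ℝ} {h : ℝ} (hh : 0 < h)
    (q : EuclideanSpace ℝ (Fin m)) :
    ∫ x, G (h⁻¹ • (q - x)) = h ^ m * ∫ u, G u := by
  rw [integral_sub_left_eq_self (fun z => G (h⁻¹ • z)) volume q,
    Measure.integral_comp_inv_smul_of_nonneg volume G hh.le]
  simp

theorem integral_comp_inv_smul_sub' {G : EuclideanSpace ℝ (Fin m) → ℝ} {h : ℝ} (hh : 0 < h)
    (x : EuclideanSpace ℝ (Fin m)) :
    ∫ q, G (h⁻¹ • (q - x)) = h ^ m * ∫ u, G u := by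
  rw [integral_sub_right_eq_self (fun z => G (h⁻¹ • z)) x,
    Measure.integral_comp_inv_smul_of_nonneg volume G hh.le]
  simp

theorem integrable_comp_inv_smul_sub {G : EuclideanSpace ℝ (Fin m) → ℝ} (hG : Integrable G)
    {h : ℝ} (hh : 0 < h) (q : EuclideanSpace ℝ (Fin m)) :
    Integrable fun x => G (h⁻¹ • (q - x)) :=
  (hG.comp_smul (inv_ne_zero hh.ne')).comp_sub_left q

theorem integrable_comp_inv_smul_sub' {G : EuclideanSpace ℝ (Fin m) → ℝ} (hG : Integrable G)
    {h : ℝ} (hh : 0 < h) (x : EuclideanSpace ℝ (Fin m)) :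
    Integrable fun q => G (h⁻¹ • (q - x)) :=
  (hG.comp_smul (inv_ne_zero hh.ne')).comp_sub_right x

theorem integrable_sq_of_abs_le {κ : ℝ} (hK : Integrable K) (hκ : ∀ u, |K u| ≤ κ) :
    Integrable fun u => K u ^ 2 := by
  simp_rw [sq]
  exact hK.bdd_mul hK.aestronglyMeasurable (ae_of_all _ hκ)

variable {f : EuclideanSpace ℝ (Fin m) → ℝ} {ν : Measure (EuclideanSpace ℝ (Fin m))}

theorem integral_withDensity_ofReal (hf : Measurable f) (hf0 : ∀ x, 0 ≤ f x)
    (hν : ν = volume.withDensity fun x => ENNReal.ofReal (f x))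
    (G : EuclideanSpace ℝ (Fin m) → ℝ) : ∫ x, G x ∂ν = ∫ x, f x * G x := by
  rw [hν, integral_withDensity_eq_integral_toReal_smul (by fun_prop)
    (ae_of_all _ fun _ => ENNReal.ofReal_lt_top)]
  simp_rw [ENNReal.toReal_ofReal (hf0 _), smul_eq_mul]

theorem integral_kernel_withDensity (hf : Measurable f) (hf0 : ∀ x, 0 ≤ f x)
    (hν : ν = volume.withDensity fun x => ENNReal.ofReal (f x)) {h : ℝ} (hh : 0 < h)
    (q : EuclideanSpace ℝ (Fin m)) :
    ∫ x, K (h⁻¹ • (q - x)) ∂ν = h ^ m * ∫ u, f (q - h • u) * K u := by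
  rw [integral_withDensity_ofReal hf hf0 hν,
    ← integral_comp_inv_smul_sub (G := fun u => f (q - h • u) * K u) hh q]
  simp [smul_smul, hh.ne']

theorem integral_kernel_sq_withDensity_le (hf : Measurable f) (hf0 : ∀ x, 0 ≤ f x)
    (hν : ν = volume.withDensity fun x => ENNReal.ofReal (f x)) {D : ℝ} (hD : ∀ x, f x ≤ D)
    (hK : Integrable fun u => K u ^ 2) {h : ℝ} (hh : 0 < h) (q : EuclideanSpace ℝ (Fin m)) :
    ∫ x, K (h⁻¹ • (q - x)) ^ 2 ∂ν ≤ D * (h ^ m * ∫ u, K u ^ 2) := by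
  rw [integral_withDensity_ofReal hf hf0 hν,
    ← integral_comp_inv_smul_sub (G := fun u => K u ^ 2) hh q, ← integral_const_mul]
  refine integral_mono_of_nonneg (ae_of_all _ fun x => mul_nonneg (hf0 x) (sq_nonneg _))
    ((integrable_comp_inv_smul_sub hK hh q).const_mul D) (ae_of_all _ fun x => ?_)
  exact mul_le_mul_of_nonneg_right (hD x) (sq_nonneg _)

/-- Tonelli: the integral over `q` does not depend on `x`, and `ν` has mass one. -/
theorem lintegral_integral_kernel_sq [IsProbabilityMeasure ν] {κ : ℝ} (hκ : ∀ u, |K u| ≤ κ)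
    (hKc : Continuous K) (hK : Integrable fun u => K u ^ 2) {h : ℝ} (hh : 0 < h) :
    ∫⁻ q, ENNReal.ofReal (∫ x, K (h⁻¹ • (q - x)) ^ 2 ∂ν) =
      ENNReal.ofReal (h ^ m * ∫ u, K u ^ 2) := by
  have h1 : ∀ q, ENNReal.ofReal (∫ x, K (h⁻¹ • (q - x)) ^ 2 ∂ν) =
      ∫⁻ x, ENNReal.ofReal (K (h⁻¹ • (q - x)) ^ 2) ∂ν := fun q => by
    refine ofReal_integral_eq_lintegral_ofReal (Integrable.of_bound
      (Continuous.aestronglyMeasurable (by fun_prop)) (κ ^ 2) (ae_of_all _ fun x => ?_))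
      (ae_of_all _ fun x => sq_nonneg _)
    rw [norm_pow]
    gcongr
    exact hκ _
  simp_rw [h1]
  rw [lintegral_lintegral_swap]
  · have h2 : ∀ x, ∫⁻ q, ENNReal.ofReal (K (h⁻¹ • (q - x)) ^ 2) =
        ENNReal.ofReal (h ^ m * ∫ u, K u ^ 2) := fun x => by
      rw [← integral_comp_inv_smul_sub' (G := fun u => K u ^ 2) hh x]
      exact (ofReal_integral_eq_lintegral_ofReal (integrable_comp_inv_smul_sub' hK hh x)
        (ae_of_all _ fun x => sq_nonneg _)).symm
    simp_rw [h2]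
    simp
  · refine (ENNReal.continuous_ofReal.comp ?_).measurable.aemeasurable
    fun_prop

variable {Ω : Type*} [MeasurableSpace Ω] {Pr : Measure Ω} [IsProbabilityMeasure Pr]
  {X : ℕ → Ω → EuclideanSpace ℝ (Fin m)}

/-- Tail bound, uniform over `ℝᵐ`, for the stochastic part of the kernel density estimate. -/
theorem exists_measure_kernel_deviation_le [IsProbabilityMeasure ν]
    (hf : Measurable f) (hf0 : ∀ x, 0 ≤ f x)
    (hν : ν = volume.withDensity fun x => ENNReal.ofReal (f x)) {D : ℝ} (hD : ∀ x, f x ≤ D)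
    (hK : Integrable K) {κ : ℝ} (hκ : ∀ u, |K u| ≤ κ) {L : ℝ} (hL : 0 < L)
    (hKL : ∀ u v, |K u - K v| ≤ L * ‖u - v‖) (hKc : Continuous K)
    (hX : ∀ i, Measurable (X i)) (hlaw : ∀ i, HasLaw (X i) ν Pr) (hind : iIndepFun X Pr)
    (s : ℕ) {c : ℝ} (hc : 0 < c) :
    ∃ a C : ℝ, 0 < a ∧ ∀ (M : ℕ) (g h : ℝ), 2 ≤ M → 0 < g → (M : ℝ)⁻¹ ≤ g →
      c * g ≤ h → Real.log M = M * g ^ (2 * s + m) → g ^ s * (c ^ m)⁻¹ * (2 * κ) ≤ 1 →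
      Pr {ω | ∃ q, a * g ^ s * (M * h ^ m) ≤ |∑ i ∈ Finset.range M,
        (K (h⁻¹ • (q - X i ω)) - ∫ x, K (h⁻¹ • (q - x)) ∂ν)|} ≤
        ENNReal.ofReal (C * ((M : ℝ) ^ 2)⁻¹) := by
  have hK2 := integrable_sq_of_abs_le hK hκ
  set k₂ := ∫ u, K u ^ 2 with hk₂
  have hk₂0 : 0 ≤ k₂ := integral_nonneg fun _ => sq_nonneg _
  have hD0 : 0 ≤ D := (hf0 0).trans (hD 0)
  have hκ0 : 0 ≤ κ := (abs_nonneg _).trans (hκ 0)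
  set A := (c ^ m)⁻¹ with hA
  have hA0 : 0 < A := by positivity
  set B := A * D * k₂ with hB
  have hB0 : 0 ≤ B := by positivity
  -- With `l = log M`, the numerator is of order `exp ((1 + B) * l)` and the ball volume at least of
  -- order `exp (-(s + m + 1) * m * l)`; this `a` leaves exactly `exp (-2 * l)`.
  set a : ℝ := 2 * (3 + B + (s + m + 1) * m) with ha
  have ha6 : 6 ≤ a := by rw [ha]; have : 0 ≤ ((s : ℝ) + m + 1) * m := by positivity
                         linarith
  set ρ := c ^ (m + 1) / L with hρ
  have hρ0 : 0 < ρ := by positivity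
  set w := (volume (Metric.ball (0 : EuclideanSpace ℝ (Fin m)) 1)).toReal with hw
  have hwtop : volume (Metric.ball (0 : EuclideanSpace ℝ (Fin m)) 1) ≠ ∞ :=
    measure_ball_lt_top.ne
  have hw0 : 0 < w := ENNReal.toReal_pos (Metric.measure_ball_pos _ _ one_pos).ne' hwtop
  refine ⟨a, 4 * A * k₂ / (ρ ^ m * w), by positivity, fun M g h hM hg hMg hgh hlog hsmall => ?_⟩
  have hM0 : (0 : ℝ) < M := by exact_mod_cast (by lia : 0 < M)
  have hh : 0 < h := lt_of_lt_of_le (by positivity) hgh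
  set l := Real.log M with hl
  have hl0 : 0 < l := Real.log_pos (by exact_mod_cast (by lia : 1 < M))
  have hexp : Real.exp l = M := Real.exp_log hM0
  have hgm : g ^ m / h ^ m ≤ A := by
    rw [hA, div_le_iff₀ (by positivity), ← div_eq_inv_mul, le_div_iff₀ (by positivity),
      mul_comm, ← mul_pow]
    gcongr
  -- Both the variance term `M * t ^ 2 * h ^ m` and the gain `t * r / 2` become multiples of `l`,
  -- the former with a factor at most `A`.
  set t := g ^ s * (g ^ m / h ^ m) with ht
  have ht0 : 0 < t := by positivity
  have htl : M * t ^ 2 * h ^ m = l * (g ^ m / h ^ m) := by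
    rw [hlog, ht]; field_simp; ring
  have htl' : M * t ^ 2 * h ^ m ≤ l * A := by rw [htl]; gcongr
  set r := a * g ^ s * (M * h ^ m) with hr
  have hr0 : 0 < r := by positivity
  have htr : t * (r / 2) = a / 2 * l := by
    rw [hlog, ht, hr]; field_simp; ring
  have hlip : ∀ x q q' : EuclideanSpace ℝ (Fin m),
      |K (h⁻¹ • (q - x)) - K (h⁻¹ • (q' - x))| ≤ L * h⁻¹ * ‖q - q'‖ := fun x q q' => by
    refine (hKL _ _).trans_eq ?_
    rw [← smul_sub, sub_sub_sub_cancel_right, norm_smul, norm_inv, Real.norm_eq_abs,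
      abs_of_pos hh, mul_assoc]
  refine (measure_exists_le_abs_sum_le (μ := volume) (t := t) hX hlaw hind
    (g := fun q x => K (h⁻¹ • (q - x)))
    (Continuous.measurable (by simp only [Function.uncurry_def]; fun_prop)) (fun q x => hκ _) ht0
    (le_trans (by rw [ht]; gcongr) hsmall) M
    (integral_kernel_sq_withDensity_le hf hf0 hν hD hK2 hh) (by positivity) hr0 hlip
    (by lia)).trans ?_
  rw [lintegral_integral_kernel_sq hκ hKc hK2 hh, ← hk₂, Measure.addHaar_ball_of_pos _ _ (by positivity),
    ← ENNReal.ofReal_toReal hwtop, ← hw, htr, ← ENNReal.ofReal_mul (by positivity),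
    ← ENNReal.ofReal_mul (by positivity), ← ENNReal.ofReal_mul
      (sub_nonneg.2 (Real.one_le_cosh _)), finrank_euclideanSpace_fin,
    ← ENNReal.ofReal_div_of_pos (mul_pos (sub_pos.2 (Real.one_lt_cosh.2 (by positivity)))
      (by positivity))]
  refine ENNReal.ofReal_le_ofReal ?_
  have hnum : M * t ^ 2 * Real.exp (M * t ^ 2 * (D * (h ^ m * k₂))) * (h ^ m * k₂) ≤
      A * k₂ * Real.exp ((1 + B) * l) := by
    have h1 : M * t ^ 2 * (D * (h ^ m * k₂)) ≤ B * l := by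
      calc _ = M * t ^ 2 * h ^ m * (D * k₂) := by ring
        _ ≤ l * A * (D * k₂) := by gcongr
        _ = _ := by rw [hB]; ring
    calc _ = M * t ^ 2 * h ^ m * k₂ * Real.exp (M * t ^ 2 * (D * (h ^ m * k₂))) := by ring
      _ ≤ l * A * k₂ * Real.exp (B * l) := by gcongr
      _ ≤ Real.exp l * A * k₂ * Real.exp (B * l) := by
          gcongr
          linarith [Real.add_one_le_exp l]
      _ = _ := by rw [add_mul, one_mul, Real.exp_add]; ring
  have hcosh : Real.exp (a / 2 * l) / 4 ≤ Real.cosh (a / 2 * l) - 1 := by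
    have h1 : 4 ≤ Real.exp (a / 2 * l) := by
      calc (4 : ℝ) ≤ (M : ℝ) ^ 2 := by
            have : (2 : ℝ) ≤ M := by exact_mod_cast hM
            nlinarith
        _ = Real.exp (2 * l) := by rw [← hexp, ← Real.exp_nat_mul]; norm_num
        _ ≤ _ := by gcongr; linarith
    rw [Real.cosh_eq]
    have := Real.exp_pos (-(a / 2 * l))
    linarith
  -- The radius shrinks only polynomially in `M`, by `1 / M ≤ g` and `c * g ≤ h`.
  have hrad : ρ * Real.exp (-((s + m + 1) * l)) ≤ r / (2 * (M * (2 * (L * h⁻¹)))) := by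
    have h1 : Real.exp (-l) ≤ g := by rw [Real.exp_neg, hexp]; exact hMg
    calc ρ * Real.exp (-((s + m + 1) * l)) = ρ * Real.exp (-l) ^ (s + m + 1) := by
          rw [← Real.exp_nat_mul]; push_cast; ring_nf
      _ ≤ ρ * g ^ (s + m + 1) := by gcongr
      _ = g ^ s * (c * g) ^ (m + 1) / L := by rw [hρ]; ring
      _ ≤ g ^ s * h ^ (m + 1) / L := by gcongr
      _ ≤ a / 4 * (g ^ s * h ^ (m + 1) / L) := by
          refine le_mul_of_one_le_left (by positivity) (by linarith)
      _ = _ := by rw [hr]; field_simp; ring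
  have hpow : Real.exp ((1 + B) * l) / (Real.exp (a / 2 * l) *
      Real.exp (-((s + m + 1) * l)) ^ m) = ((M : ℝ) ^ 2)⁻¹ := by
    rw [← hexp, ← Real.exp_nat_mul, ← Real.exp_nat_mul, ← Real.exp_add, ← Real.exp_sub,
      ← Real.exp_neg, ha]
    congr 1
    push_cast
    ring
  calc _ ≤ A * k₂ * Real.exp ((1 + B) * l) / (Real.exp (a / 2 * l) / 4 *
        ((ρ * Real.exp (-((s + m + 1) * l))) ^ m * w)) :=
        div_le_div₀ (by positivity) hnum (by positivity) (mul_le_mul hcosh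
          (mul_le_mul_of_nonneg_right (pow_le_pow_left₀ (by positivity) hrad m) hw0.le)
          (by positivity) (sub_nonneg.2 (Real.one_le_cosh _)))
    _ = 4 * A * k₂ / (ρ ^ m * w) * (Real.exp ((1 + B) * l) /
        (Real.exp (a / 2 * l) * Real.exp (-((s + m + 1) * l)) ^ m)) := by
      generalize Real.exp (a / 2 * l) = e₁
      generalize Real.exp (-((s + m + 1) * l)) = e₂
      simp only [div_eq_mul_inv, mul_inv, inv_inv, mul_pow]
      ring
    _ = _ := by rw [hpow]

end Smoothing

/-! ### The rate and the bandwidths -/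

section Rate

theorem log_div_self_pos {M : ℕ} (hM : 2 ≤ M) : 0 < Real.log M / M :=
  div_pos (Real.log_pos (by exact_mod_cast (by lia : 1 < M)))
    (by exact_mod_cast (by lia : 0 < M))

theorem kdeRate_pos (s m : ℕ) {M : ℕ} (hM : 2 ≤ M) : 0 < kdeRate s m M :=
  Real.rpow_pos_of_pos (log_div_self_pos hM) _

theorem kdeRate_eq_pow (s m : ℕ) {M : ℕ} (hM : 2 ≤ M) :
    kdeRate s m M = ((Real.log M / M) ^ ((1 : ℝ) / (2 * s + m))) ^ s := by
  rw [kdeRate, ← Real.rpow_natCast, ← Real.rpow_mul (log_div_self_pos hM).le]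
  congr 1
  ring

theorem rateBandwidth_pow {s m : ℕ} (hs : 1 ≤ s) {M : ℕ} (hM : 2 ≤ M) :
    ((Real.log M / M) ^ ((1 : ℝ) / (2 * s + m))) ^ (2 * s + m) = Real.log M / M := by
  have : (2 * s + m : ℝ) ≠ 0 := by
    have : (1 : ℝ) ≤ s := by exact_mod_cast hs
    positivity
  rw [← Real.rpow_natCast, ← Real.rpow_mul (log_div_self_pos hM).le]
  push_cast
  rw [one_div_mul_cancel this, Real.rpow_one]

theorem inv_le_rateBandwidth {s m : ℕ} (hs : 1 ≤ s) {M : ℕ} (hM : 3 ≤ M) :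
    (M : ℝ)⁻¹ ≤ (Real.log M / M) ^ ((1 : ℝ) / (2 * s + m)) := by
  have hM0 : (0 : ℝ) < M := by exact_mod_cast (by lia : 0 < M)
  refine le_of_pow_le_pow_left₀ (n := 2 * s + m) (by lia)
    (Real.rpow_nonneg (log_div_self_pos (by lia)).le _) ?_
  rw [rateBandwidth_pow hs (by lia), div_eq_inv_mul]
  -- This is where `3 ≤ M` is needed: `exp 1 < 3`.
  have h1 : (1 : ℝ) ≤ Real.log M := by
    rw [Real.le_log_iff_exp_le hM0]
    have : (3 : ℝ) ≤ M := by exact_mod_cast hM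
    linarith [Real.exp_one_lt_d9]
  calc (M : ℝ)⁻¹ ^ (2 * s + m) ≤ (M : ℝ)⁻¹ ^ 1 :=
        pow_le_pow_of_le_one (by positivity)
          (inv_le_one_of_one_le₀ (by exact_mod_cast (by lia : 1 ≤ M))) (by lia)
    _ ≤ _ := by rw [pow_one]; exact le_mul_of_one_le_right (by positivity) h1

theorem tendsto_rateBandwidth {s m : ℕ} (hs : 1 ≤ s) :
    Tendsto (fun M : ℕ => (Real.log M / M) ^ ((1 : ℝ) / (2 * s + m))) atTop (𝓝 0) := by
  have hpos : (0 : ℝ) < 1 / (2 * s + m) := by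
    have : (1 : ℝ) ≤ s := by exact_mod_cast hs
    positivity
  have h1 : Tendsto (fun M : ℕ => Real.log M / M) atTop (𝓝 0) :=
    (Real.isLittleO_log_id_atTop.tendsto_div_nhds_zero).comp tendsto_natCast_atTop_atTop
  have h2 := h1.rpow_const (p := (1 : ℝ) / (2 * s + m)) (.inr hpos.le)
  rwa [Real.zero_rpow hpos.ne'] at h2

theorem IsRateBandwidth.exists_bounds {s m : ℕ} {h : ℕ → ℝ} (hh : IsRateBandwidth s m h) :
    ∃ c₁ c₂ : ℝ, 0 < c₁ ∧ 0 < c₂ ∧ ∀ᶠ M : ℕ in atTop,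
      c₁ * (Real.log M / M) ^ ((1 : ℝ) / (2 * s + m)) ≤ h M ∧
      h M ≤ c₂ * (Real.log M / M) ^ ((1 : ℝ) / (2 * s + m)) := by
  obtain ⟨c₂, hc₂, h₂⟩ := hh.2.1.exists_pos
  obtain ⟨c₁, hc₁, h₁⟩ := hh.2.2.exists_pos
  refine ⟨c₁⁻¹, c₂, by positivity, hc₂, ?_⟩
  filter_upwards [h₁.bound, h₂.bound, eventually_ge_atTop 2] with M b₁ b₂ hM
  have e1 : ‖h M‖ = h M := by rw [Real.norm_eq_abs, abs_of_pos (hh.1 M hM)]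
  rw [e1, Real.norm_eq_abs, abs_of_nonneg (Real.rpow_nonneg (log_div_self_pos hM).le _)] at b₁ b₂
  exact ⟨by rwa [inv_mul_le_iff₀ hc₁], b₂⟩

end Rate

/-! ### Almost sure uniform rate for the exact model -/

section Uniform
variable {m : ℕ} {K f : EuclideanSpace ℝ (Fin m) → ℝ} {ν : Measure (EuclideanSpace ℝ (Fin m))}
  {Ω : Type*} [MeasurableSpace Ω] {Pr : Measure Ω} [IsProbabilityMeasure Pr]

/-- The kernel density estimate of a smooth density converges to it almost surely at the optimal
rate, uniformly on `ℝᵐ`. -/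
theorem exists_ae_eventually_abs_sub_kde_le [IsProbabilityMeasure ν]
    (hf0 : ∀ x, 0 ≤ f x) (hν : ν = volume.withDensity fun x => ENNReal.ofReal (f x))
    {D : ℝ} (hD : ∀ x, f x ≤ D) {s : ℕ} (hs : 1 ≤ s) (hf : ContDiff ℝ s f)
    (huc : UniformContinuous (iteratedFDeriv ℝ s f)) (hK : IsKernelOfOrder s K) {κ : ℝ}
    (hκ : ∀ u, |K u| ≤ κ) {L : ℝ} (hL : 0 < L) (hKL : ∀ u v, |K u - K v| ≤ L * ‖u - v‖)
    (hKc : Continuous K) {h : ℕ → ℝ} (hh : IsRateBandwidth s m h)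
    {X : ℕ → Ω → EuclideanSpace ℝ (Fin m)} (hX : ∀ i, Measurable (X i))
    (hlaw : ∀ i, HasLaw (X i) ν Pr) (hind : iIndepFun X Pr) :
    ∃ C : ℝ, 0 < C ∧ ∀ᵐ ω ∂Pr, ∀ᶠ M : ℕ in atTop, ∀ q,
      |f q - kde K (h M) M (fun i => X i ω) q| ≤ C * kdeRate s m M := by
  have hfm : Measurable f := hf.continuous.measurable
  obtain ⟨c₁, c₂, hc₁, hc₂, hc⟩ := hh.exists_bounds
  obtain ⟨β, hβ0, hβ⟩ := hK.exists_abs_integral_sub_le hs hf huc (D := D)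
    fun x => by rw [abs_of_nonneg (hf0 x)]; exact hD x
  obtain ⟨a, C, ha, H⟩ := exists_measure_kernel_deviation_le hfm hf0 hν hD hK.integrable hκ hL
    hKL hKc hX hlaw hind s hc₁
  set G : ℕ → ℝ := fun M => (Real.log M / M) ^ ((1 : ℝ) / (2 * s + m)) with hG
  let bad : ℕ → Set Ω := fun M => {ω | ∃ q, a * G M ^ s * (M * h M ^ m) ≤
    |∑ i ∈ Finset.range M,
      (K ((h M)⁻¹ • (q - X i ω)) - ∫ x, K ((h M)⁻¹ • (q - x)) ∂ν)|}
  have hsmall : ∀ᶠ M : ℕ in atTop, G M ^ s * (c₁ ^ m)⁻¹ * (2 * κ) ≤ 1 := by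
    have h1 := (((tendsto_rateBandwidth (m := m) hs).pow s).mul_const (c₁ ^ m)⁻¹).mul_const
      (2 * κ)
    rw [zero_pow (by lia), zero_mul, zero_mul] at h1
    exact h1.eventually_le_const one_pos
  -- The tail bound holds only from some `N` on, so Borel-Cantelli is applied to the shifted events.
  obtain ⟨N, hN⟩ := eventually_atTop.1 (hc.and (hsmall.and (eventually_ge_atTop 3)))
  have hbad : ∀ M, Pr (bad (M + N)) ≤ ENNReal.ofReal (C * (((M + N : ℕ) : ℝ) ^ 2)⁻¹) := by
    intro M
    obtain ⟨h1, h2, h3⟩ := hN (M + N) (by lia)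
    have hM2 : 2 ≤ M + N := by lia
    refine H (M + N) (G (M + N)) (h (M + N)) hM2
      (Real.rpow_pos_of_pos (log_div_self_pos hM2) _) (inv_le_rateBandwidth hs h3) h1.1 ?_ h2
    rw [rateBandwidth_pow hs hM2, mul_div_cancel₀]
    exact_mod_cast (by lia : M + N ≠ 0)
  have hsum : ∑' M, Pr (bad (M + N)) ≠ ∞ := by
    refine ne_top_of_le_ne_top ?_ (ENNReal.tsum_le_tsum hbad)
    have : Summable fun M : ℕ => C * (((M + N : ℕ) : ℝ) ^ 2)⁻¹ :=
      ((summable_nat_add_iff N).2 (Real.summable_nat_pow_inv.2 one_lt_two)).mul_left C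
    exact this.tsum_ofReal_ne_top
  refine ⟨a + β * c₂ ^ s, by positivity, ?_⟩
  filter_upwards [ae_eventually_notMem hsum] with ω hω
  have hω' : ∀ᶠ M in atTop, ω ∉ bad M := by
    obtain ⟨N', hN'⟩ := eventually_atTop.1 hω
    filter_upwards [eventually_ge_atTop (N' + N)] with M hM
    have := hN' (M - N) (by lia)
    rwa [Nat.sub_add_cancel (by lia)] at this
  filter_upwards [hω', hc, eventually_ge_atTop 2] with M hM hcM hM2 q
  have hM0 : (0 : ℝ) < M := by exact_mod_cast (by lia : 0 < M)
  have hhM : 0 < h M := hh.1 M hM2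
  have hG0 : 0 < G M := Real.rpow_pos_of_pos (log_div_self_pos hM2) _
  rw [kdeRate_eq_pow s m hM2]
  change _ ≤ _ * G M ^ s
  have h1 : |∑ i ∈ Finset.range M,
      (K ((h M)⁻¹ • (q - X i ω)) - ∫ x, K ((h M)⁻¹ • (q - x)) ∂ν)| ≤
      a * G M ^ s * (M * h M ^ m) := by
    by_contra hcon
    exact hM ⟨q, (not_le.1 hcon).le⟩
  have h2 := hβ (h M) hhM q
  have h3 : h M ^ s ≤ (c₂ * G M) ^ s := by gcongr; exact hcM.2
  -- Stochastic part plus bias; they account for `a` and `β * c₂ ^ s` in the constant.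
  have h4 : kde K (h M) M (fun i => X i ω) q - f q =
      (∑ i ∈ Finset.range M,
        (K ((h M)⁻¹ • (q - X i ω)) - ∫ x, K ((h M)⁻¹ • (q - x)) ∂ν)) / (M * h M ^ m) +
      ((∫ u, f (q - h M • u) * K u) - f q) := by
    rw [kde, Finset.sum_sub_distrib, Finset.sum_const, Finset.card_range, nsmul_eq_mul,
      integral_kernel_withDensity hfm hf0 hν hhM]
    field_simp
    ring
  rw [abs_sub_comm, h4]
  refine (abs_add_le _ _).trans ?_
  rw [add_mul]
  refine add_le_add ?_ ?_
  · rw [abs_div, abs_of_pos (by positivity : 0 < (M : ℝ) * h M ^ m)]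
    exact (div_le_iff₀ (by positivity)).2 h1
  · calc _ ≤ β * h M ^ s := h2
      _ ≤ β * (c₂ * G M) ^ s := by gcongr
      _ = _ := by ring

end Uniform

/-! ### Replacing the model -/

section Model
variable {m : ℕ} {K : EuclideanSpace ℝ (Fin m) → ℝ}

/-- A crude bound for the finitely many `M` that the asymptotic estimate misses. -/
theorem abs_kde_le {κ : ℝ} (hκ : ∀ u, |K u| ≤ κ) {h : ℝ} (hh : 0 < h) (M : ℕ)
    (x : ℕ → EuclideanSpace ℝ (Fin m)) (q : EuclideanSpace ℝ (Fin m)) :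
    |kde K h M x q| ≤ κ / h ^ m := by
  rcases Nat.eq_zero_or_pos M with rfl | hM
  · have : 0 ≤ κ := (abs_nonneg _).trans (hκ 0)
    simp only [kde, Finset.range_zero, Finset.sum_empty, mul_zero, abs_zero]
    positivity
  · have hM0 : (0 : ℝ) < M := by exact_mod_cast hM
    rw [kde, abs_mul, abs_of_pos (by positivity)]
    calc _ ≤ 1 / (M * h ^ m) * ∑ i ∈ Finset.range M, κ := by
          gcongr
          exact (Finset.abs_sum_le_sum_abs _ _).trans (Finset.sum_le_sum fun i _ => hκ _)
      _ = _ := by simp; field_simp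

theorem abs_kde_sub_kde_le {L : ℝ} (hL : 0 ≤ L) (hKL : ∀ u v, |K u - K v| ≤ L * ‖u - v‖)
    {h : ℝ} (hh : 0 < h) {M : ℕ} (hM : 0 < M) {x y : ℕ → EuclideanSpace ℝ (Fin m)}
    {q q' : EuclideanSpace ℝ (Fin m)} {e : ℝ} (hq : ‖q - q'‖ ≤ e) (hxy : ∀ i, ‖x i - y i‖ ≤ e) :
    |kde K h M x q - kde K h M y q'| ≤ 2 * L * (1 / h ^ (m + 1) * e) := by
  have hM0 : (0 : ℝ) < M := by exact_mod_cast hM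
  rw [kde, kde, ← mul_sub, ← Finset.sum_sub_distrib, abs_mul, abs_of_pos (by positivity)]
  calc _ ≤ 1 / (M * h ^ m) * ∑ i ∈ Finset.range M, L * (h⁻¹ * (e + e)) := by
        gcongr
        refine (Finset.abs_sum_le_sum_abs _ _).trans (Finset.sum_le_sum fun i _ => ?_)
        refine (hKL _ _).trans ?_
        rw [← smul_sub, norm_smul, norm_inv, Real.norm_eq_abs, abs_of_pos hh]
        gcongr
        rw [sub_sub_sub_comm]
        exact (norm_sub_le _ _).trans (add_le_add hq (hxy i))
    _ = _ := by simp; field_simp; ring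

end Model

/-! ### Assembly of the two error bounds -/

theorem kdeErrorBounds_of_uniform {k m : ℕ} {Λ : Set (EuclideanSpace ℝ (Fin k))}
    {μΛ : Measure Λ} {Q Q' : Λ → EuclideanSpace ℝ (Fin m)}
    {dens K : EuclideanSpace ℝ (Fin m) → ℝ} {s : ℕ} {h : ℝ} (hh : 0 < h) {M : ℕ} (hM : 2 ≤ M)
    {l : ℕ → Λ} {C₀ C L : ℝ} (hL : 0 ≤ L) (hKL : ∀ u v, |K u - K v| ≤ L * ‖u - v‖)
    (hunif : ∀ q, |dens q - kde K h M (fun i => Q (l i)) q| ≤ C₀ * kdeRate s m M)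
    (hl : ∀ i, ‖Q (l i) - Q' (l i)‖ₑ ≤ eLpNorm (fun x => Q x - Q' x) ∞ μΛ)
    (hC : 0 < C) (hC₀ : C₀ ≤ C) (hLC : 2 * L ≤ C) :
    KDEErrorBounds μΛ Q Q' dens K s h M l C := by
  have hrate := kdeRate_pos s m hM
  unfold KDEErrorBounds
  set e := eLpNorm (fun x => Q x - Q' x) ∞ μΛ with he
  rcases eq_or_ne e ∞ with htop | htop
  · have : ENNReal.ofReal C * (ENNReal.ofReal (kdeRate s m M) +
        ENNReal.ofReal (1 / h ^ (m + 1)) * e) = ∞ := by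
      rw [htop, ENNReal.mul_top (ENNReal.ofReal_pos.2 (by positivity)).ne', add_top,
        ENNReal.mul_top (ENNReal.ofReal_pos.2 hC).ne']
    rw [this]
    exact ⟨le_top, le_top⟩
  have hnorm : ∀ v : EuclideanSpace ℝ (Fin m), ‖v‖ₑ ≤ e → ‖v‖ ≤ e.toReal := fun v hv => by
    rw [← toReal_enorm]
    exact ENNReal.toReal_mono htop hv
  have hRHS : ENNReal.ofReal C * (ENNReal.ofReal (kdeRate s m M) +
      ENNReal.ofReal (1 / h ^ (m + 1)) * e) =
      ENNReal.ofReal (C * (kdeRate s m M + 1 / h ^ (m + 1) * e.toReal)) := by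
    rw [ENNReal.ofReal_mul hC.le, ENNReal.ofReal_add hrate.le (by positivity),
      ENNReal.ofReal_mul (by positivity), ENNReal.ofReal_toReal htop]
  -- Serves both bounds: `q' = q` for the first, `q = Q x` and `q' = Q' x` for the second.
  have key : ∀ q q', ‖q - q'‖ ≤ e.toReal →
      ‖dens q - kde K h M (fun i => Q' (l i)) q'‖ ≤
        C * (kdeRate s m M + 1 / h ^ (m + 1) * e.toReal) := fun q q' hq => by
    have h1 := hunif q
    have h2 := abs_kde_sub_kde_le hL hKL hh (by lia : 0 < M) hq fun i => hnorm _ (hl i)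
    have h3 := abs_sub_le (dens q) (kde K h M (fun i => Q (l i)) q)
      (kde K h M (fun i => Q' (l i)) q')
    rw [Real.norm_eq_abs, mul_add]
    refine h3.trans (add_le_add (h1.trans (by gcongr)) (h2.trans ?_))
    gcongr
  rw [hRHS]
  refine ⟨?_, ?_⟩
  · rw [eLpNorm_exponent_top]
    exact eLpNormEssSup_le_of_ae_bound (ae_of_all _ fun q => key q q (by simp))
  · rw [eLpNorm_exponent_top]
    refine eLpNormEssSup_le_of_ae_bound ?_
    have : ∀ᵐ x ∂μΛ, ‖Q x - Q' x‖ₑ ≤ e := by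
      rw [he, eLpNorm_exponent_top]
      exact ae_le_eLpNormEssSup
    filter_upwards [this] with x hx
    exact key _ _ (hnorm _ hx)

theorem mainTheorem3 {k m : ℕ} {Λ : Set (EuclideanSpace ℝ (Fin k))}
    -- the parameter space, its dominating measure, the probability measure with its density
    (μΛ PΛ : Measure Λ) [IsProbabilityMeasure PΛ]
    (densΛ : Λ → ℝ≥0∞) (hdensΛ : Measurable densΛ) (hPΛ : PΛ = μΛ.withDensity densΛ)
    -- the map and the Lebesgue density of the push-forward
    (Q : Λ → EuclideanSpace ℝ (Fin m)) (hQ : Measurable Q)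
    (dens : EuclideanSpace ℝ (Fin m) → ℝ) (hdens_nonneg : ∀ q, 0 ≤ dens q)
    (hdens : PΛ.map Q = volume.withDensity (fun q => ENNReal.ofReal (dens q)))
    -- regularity of the density, kernel and bandwidth
    (s : ℕ) (hs : 1 ≤ s) (hdens_smooth : ContDiff ℝ s dens)
    (hdens_uc : UniformContinuous dens)
    (hdens_uc' : UniformContinuous (iteratedFDeriv ℝ s dens))
    (K : EuclideanSpace ℝ (Fin m) → ℝ) (hK : IsKernelOfOrder s K)
    (hK_bdd : ∃ κ : ℝ, ∀ u, |K u| ≤ κ) (hK_lip : ∃ L, LipschitzWith L K)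
    (h : ℕ → ℝ) (hh : IsRateBandwidth s m h)
    -- independent samples of the parameters
    {Ω : Type*} [MeasurableSpace Ω] (Pr : Measure Ω) [IsProbabilityMeasure Pr]
    (lam : ℕ → Ω → Λ) (hlam_law : ∀ i, HasLaw (lam i) PΛ Pr) (hlam_indep : iIndepFun lam Pr) :
    ∃ C : ℝ, 0 < C ∧
      ∀ Qn : ℕ → Λ → EuclideanSpace ℝ (Fin m), (∀ n, Measurable (Qn n)) →
        ∀ᵐ ω ∂Pr,
          (∀ᶠ M in atTop, ∀ n,
            KDEErrorBounds μΛ Q (Qn n) dens K s (h M) M (fun i => lam i ω) C) ∧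
          ∃ C' : ℝ, 0 < C' ∧ ∀ M, 2 ≤ M → ∀ n,
            KDEErrorBounds μΛ Q (Qn n) dens K s (h M) M (fun i => lam i ω) C' := by
  
  subst hPΛ
  obtain ⟨κ, hκ⟩ := hK_bdd
  obtain ⟨L', hL'⟩ := hK_lip
  set PΛ := μΛ.withDensity densΛ with hPΛ
  set L : ℝ := L' + 1 with hLdef
  have hL : 0 < L := by positivity
  have hKL : ∀ u v, |K u - K v| ≤ L * ‖u - v‖ := fun u v => by
    have h1 := hL'.dist_le_mul u v
    rw [Real.dist_eq, dist_eq_norm] at h1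
    refine h1.trans ?_
    gcongr
    simp [hLdef]
  have hprob : IsProbabilityMeasure (PΛ.map Q) := Measure.isProbabilityMeasure_map hQ.aemeasurable
  obtain ⟨D, hD⟩ := hdens_uc.exists_le_of_lintegral_ne_top (μ := volume) (by
    have h1 : (PΛ.map Q) Set.univ = 1 := measure_univ
    rw [hdens, withDensity_apply _ MeasurableSet.univ, Measure.restrict_univ] at h1
    simp [h1])
  have hae := fun i => (hlam_law i).aemeasurable
  -- The samples are only almost everywhere measurable, so measurable versions are used.
  have hmk : ∀ i, lam i =ᵐ[Pr] (hae i).mk := fun i => (hae i).ae_eq_mk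
  have hmeas : ∀ i, Measurable ((hae i).mk) := fun i => (hae i).measurable_mk
  obtain ⟨C₀, hC₀, huniform⟩ := exists_ae_eventually_abs_sub_kde_le (ν := PΛ.map Q) (Pr := Pr)
    (X := fun i => Q ∘ (hae i).mk) hdens_nonneg hdens hD hs hdens_smooth hdens_uc' hK hκ hL hKL
    hL'.continuous hh (fun i => hQ.comp (hmeas i))
    (fun i => HasLaw.comp ⟨hQ.aemeasurable, rfl⟩ ((hlam_law i).congr (hmk i).symm))
    ((hlam_indep.congr hmk).comp (fun _ => Q) fun _ => hQ)
  refine ⟨C₀ + 2 * L, by positivity, fun Qn _ => ?_⟩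
  have hmodel : ∀ᵐ ω ∂Pr, ∀ n i, ‖Q (lam i ω) - Qn n (lam i ω)‖ₑ ≤
      eLpNorm (fun x => Q x - Qn n x) ∞ μΛ := by
    refine ae_all_iff.2 fun n => ae_all_iff.2 fun i => ?_
    have h1 : ∀ᵐ x ∂PΛ, ‖Q x - Qn n x‖ₑ ≤ eLpNorm (fun x => Q x - Qn n x) ∞ μΛ := by
      -- A `μΛ`-null set is `PΛ`-null, so almost surely no sample falls into any of the countably
      -- many exceptional sets.
      refine (withDensity_absolutelyContinuous μΛ densΛ).ae_le ?_
      rw [eLpNorm_exponent_top]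
      exact ae_le_eLpNormEssSup
    rw [← (hlam_law i).map_eq] at h1
    exact ae_of_ae_map (hae i) h1
  filter_upwards [huniform, ae_all_iff.2 hmk, hmodel] with ω hω hωmk hωQ
  have hunif : ∀ᶠ M : ℕ in atTop, ∀ q,
      |dens q - kde K (h M) M (fun i => Q (lam i ω)) q| ≤ C₀ * kdeRate s m M := by
    filter_upwards [hω] with M hM q
    simpa only [Function.comp_apply, ← hωmk] using hM q
  refine ⟨?_, ?_⟩
  · filter_upwards [hunif, eventually_ge_atTop 2] with M hM hM2 n
    exact kdeErrorBounds_of_uniform (hh.1 M hM2) hM2 hL.le hKL hM (hωQ n) (by positivity)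
      (by linarith) (by linarith)
  · obtain ⟨N, hN⟩ := eventually_atTop.1 hunif
    have hκ0 : 0 ≤ κ := (abs_nonneg _).trans (hκ 0)
    have hD0 : 0 ≤ D := (hdens_nonneg 0).trans (hD 0)
    -- The ratio of the crude bound to the rate; summing over `M < N` dominates each of them. The
    -- absolute value gives nonnegativity also for `M < 2`, where the sign of `h M` is unknown.
    let c : ℕ → ℝ := fun M => |(D + κ / h M ^ m) / kdeRate s m M|
    have hc : ∀ M, 0 ≤ c M := fun M => abs_nonneg _
    have hcsum : 0 ≤ ∑ M ∈ Finset.range N, c M := Finset.sum_nonneg fun M _ => hc M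
    refine ⟨C₀ + ∑ M ∈ Finset.range N, c M + 2 * L, by positivity, fun M hM2 n => ?_⟩
    have hr := kdeRate_pos s m hM2
    refine kdeErrorBounds_of_uniform (C₀ := C₀ + ∑ M ∈ Finset.range N, c M) (hh.1 M hM2) hM2 hL.le
      hKL (fun q => ?_) (hωQ n) (by positivity) (by linarith) (by linarith)
    rcases le_or_gt N M with hNM | hNM
    · refine (hN M hNM q).trans ?_
      gcongr
      linarith
    · have h1 := abs_kde_le hκ (hh.1 M hM2) M (fun i => Q (lam i ω)) q
      have h2 := abs_sub (dens q) (kde K (h M) M (fun i => Q (lam i ω)) q)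
      rw [abs_of_nonneg (hdens_nonneg q)] at h2
      have h3 : D + κ / h M ^ m ≤ c M * kdeRate s m M :=
        (div_le_iff₀ hr).1 (le_abs_self _)
      have h4 : c M ≤ ∑ M ∈ Finset.range N, c M :=
        Finset.single_le_sum (fun i _ => hc i) (Finset.mem_range.2 hNM)
      calc _ ≤ D + κ / h M ^ m := by linarith [hD q]
        _ ≤ c M * kdeRate s m M := h3
        _ ≤ _ := by gcongr; linarith
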